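/- Let $S_k$ be the symmetric group on $\{1,\dots,k\}$. For $\sigma\in S_k$ let $\pi(\sigma)\vdash k$ be the partition of $k$ given by the lengths of all cycles of $\sigma$ (fixed points included), $c(\sigma)$ the number of cycles, and $|\sigma|=k-c(\sigma)$; for $\mu\vdash k$ with $\mathrm{ht}(\mu)$ parts let $|\mu|=k-\mathrm{ht}(\mu)$. For every real $d>k-1$ the element $\sum_{\rho\in S_k}d^{c(\rho)}\rho$ of the group algebra of $S_k$ is invertible; let $Wg(d,\sigma)$ denote the coefficient of $\sigma$ in its inverse: $$\Big(\sum_{\rho\in S_k}d^{c(\rho)}\rho\Big)^{-1}=\sum_{\sigma\in S_k}Wg(d,\sigma)\,\sigma .$$ For partitions $\mu,\mu_1,\dots,\mu_i$ of $k$ let $A[\mu;\mu_1,\dots,\mu_i]$ be the number of sequences $(\sigma_1,\dots,\sigma_i)$ in $S_k$ with $\pi(\sigma_j)=\mu_j$ for all $j$ and $\sigma_1\cdots\sigma_i=\sigma$, where $\sigma$ is any fixed permutation with $\pi(\sigma)=\mu$, and let $$C[\mu]=\sum_{i=0}^{|\mu|}(-1)^i\sum_{\substack{\mu_1,\dots,\mu_i\neq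 1^k\\ |\mu_1|+\dots+|\mu_i|=|\mu|}}A[\mu;\mu_1,\dots,\mu_i]$$ (the term $i=0$, an empty product, contributes only for $\mu=1^k$, where it is $1$). Theorem. (1) $C[\mu]$ is the leading asymptotic coefficient of the function $Wg$: for every $k$ and every $\sigma\in S_k$ with $\pi(\sigma)=\mu$, $$\lim_{d\to\infty}d^{\,k+|\sigma|}\,Wg(d,\sigma)=C[\mu].$$ (2) For every $k\ge1$, $C[(k)]=(-1)^{k-1}\mathtt C_{k-1}$, where $\mathtt C_n=\frac1{n+1}\binom{2n}{n}$ is the $n$-th Catalan number. (3) For every partition $(a_1,\dots,a_i)$ of $k$, $C[(a_1,\dots,a_i)]=\prod_{j=1}^iC[(a_j)]$, where $C[(a_j)]$ is computed in $S_{a_j}$. (4) If $\sigma=\sigma_1\sigma_2\cdots\sigma_h$ in $S_k$ with all $\sigma_j\neq1$ and $|\sigma|=|\sigma_1|+\dots+|\sigma_h|$, then every $\sigma_j$ lies in the Young subgroup $Y_\sigma$ of the permutations that map each cycle of $\sigma$ (as a subset of $\{1,\dots,k\}$, fixed points being one-element cycles) to itself. -/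

import Mathlib

open Filter Topology

noncomputable section

namespace Weingarten

/-- `π(σ)`: the partition of `k` formed by the lengths of all cycles of `σ ∈ S_k`,
fixed points included as cycles of length `1`. -/
def cyclePartition {k : ℕ} (σ : Equiv.Perm (Fin k)) : Nat.Partition k where
  parts := σ.partition.parts
  parts_pos := σ.partition.parts_pos
  parts_sum := by rw [σ.partition.parts_sum, Fintype.card_fin]

/-- The number of parts of a partition. -/
def height {k : ℕ} (μ : Nat.Partition k) : ℕ := μ.parts.card

/-- `c(σ)`: the number of cycles of `σ`, fixed points included. -/
def numCycles {k : ℕ} (σ : Equiv.Perm (Fin k)) : ℕ := height (cyclePartition σ)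

/-- `|μ| = k - ht(μ)`, where `ht(μ) ≤ k` since all parts are positive. -/
def size {k : ℕ} (μ : Nat.Partition k) : ℕ := k - height μ

/-- `|σ| = k - c(σ)`. -/
def length {k : ℕ} (σ : Equiv.Perm (Fin k)) : ℕ := size (cyclePartition σ)

/-- The element `∑_ρ d ^ c(ρ) ρ` of the group algebra of `S_k`. -/
def cycleElement (k : ℕ) (d : ℝ) : MonoidAlgebra ℝ (Equiv.Perm (Fin k)) :=
  ∑ ρ : Equiv.Perm (Fin k), MonoidAlgebra.single ρ (d ^ numCycles ρ)

/-- The Formanek–Weingarten function: `Wg(d, σ)` is the coefficient of `σ` in the inverse of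
`∑_ρ d ^ c(ρ) ρ` in the group algebra of `S_k`. -/
def Wg {k : ℕ} (d : ℝ) (σ : Equiv.Perm (Fin k)) : ℝ :=
  (Ring.inverse (cycleElement k d)).coeff σ

/-- Every partition of `k` is the cycle partition of a permutation. -/
theorem exists_cyclePartition_eq {k : ℕ} (μ : Nat.Partition k) :
    ∃ σ : Equiv.Perm (Fin k), cyclePartition σ = μ := by
  have hsplit := Multiset.filter_add_not (fun a => 2 ≤ a) μ.parts
  have hones : μ.parts.filter (fun a => ¬ 2 ≤ a) =
      Multiset.replicate (μ.parts.filter (fun a => ¬ 2 ≤ a)).card 1 := by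
    refine Multiset.eq_replicate_card.2 fun b hb => ?_
    have h1 := μ.parts_pos (Multiset.mem_of_mem_filter hb)
    have h2 := Multiset.of_mem_filter hb
    omega
  have hsum : (μ.parts.filter (fun a => 2 ≤ a)).sum +
      (μ.parts.filter (fun a => ¬ 2 ≤ a)).card = k := by
    have h := congrArg Multiset.sum hsplit
    rw [Multiset.sum_add, μ.parts_sum, hones, Multiset.sum_replicate] at h
    simpa using h
  obtain ⟨σ, hσ⟩ := (Equiv.Perm.exists_with_cycleType_iff (Fin k)
    (m := μ.parts.filter (fun a => 2 ≤ a))).2 ⟨by rw [Fintype.card_fin]; omega,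
      fun a ha => Multiset.of_mem_filter (p := fun a => 2 ≤ a) ha⟩
  refine ⟨σ, Nat.Partition.ext ?_⟩
  change σ.cycleType + Multiset.replicate (Fintype.card (Fin k) - σ.support.card) 1 = μ.parts
  rw [← Equiv.Perm.sum_cycleType, hσ, Fintype.card_fin]
  conv_rhs => rw [← hsplit, hones]
  congr 2
  omega

/-- The number of sequences `(σ₁, …, σ_i)` in `S_k` with `π(σ_j) = ν_j` and `σ₁ ⋯ σ_i = σ`. -/
def factorizationCount {k i : ℕ} (σ : Equiv.Perm (Fin k)) (ν : Fin i → Nat.Partition k) : ℕ :=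
  Nat.card {s : Fin i → Equiv.Perm (Fin k) //
    (∀ j, cyclePartition (s j) = ν j) ∧ (List.ofFn s).prod = σ}

theorem cyclePartition_conj {k : ℕ} (σ g : Equiv.Perm (Fin k)) :
    cyclePartition (g * σ * g⁻¹) = cyclePartition σ := by
  have h : IsConj σ (g * σ * g⁻¹) := isConj_iff.2 ⟨g, rfl⟩
  rw [Equiv.Perm.partition_eq_of_isConj] at h
  have h' : (g * σ * g⁻¹).partition.parts = σ.partition.parts :=
    congrArg Nat.Partition.parts h.symm
  exact Nat.Partition.ext h'

theorem factorizationCount_le_conj {k i : ℕ} (σ g : Equiv.Perm (Fin k))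
    (ν : Fin i → Nat.Partition k) :
    factorizationCount σ ν ≤ factorizationCount (g * σ * g⁻¹) ν := by
  refine Nat.card_le_card_of_injective
    (fun s => ⟨fun j => g * s.1 j * g⁻¹, fun j => ?_, ?_⟩) ?_
  · rw [cyclePartition_conj, s.2.1 j]
  · have h : (List.ofFn fun j => g * s.1 j * g⁻¹) = (List.ofFn s.1).map (MulAut.conj g) := by
      rw [List.map_ofFn]; rfl
    rw [h, ← map_list_prod, s.2.2, MulAut.conj_apply]
  · intro s t hst
    refine Subtype.ext (funext fun j => ?_)
    have h := congrFun (congrArg Subtype.val hst) j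
    exact mul_left_cancel (mul_right_cancel h)

/-- The count of factorizations depends only on the cycle partition of `σ`. -/
theorem factorizationCount_congr {k i : ℕ} {σ τ : Equiv.Perm (Fin k)}
    (h : cyclePartition σ = cyclePartition τ) (ν : Fin i → Nat.Partition k) :
    factorizationCount σ ν = factorizationCount τ ν := by
  have key : ∀ {σ τ : Equiv.Perm (Fin k)}, cyclePartition σ = cyclePartition τ →
      factorizationCount σ ν ≤ factorizationCount τ ν := by
    intro σ τ h
    have h' : σ.partition.parts = τ.partition.parts :=
      congrArg (fun p : Nat.Partition k => p.parts) h
    have hc : IsConj σ τ := Equiv.Perm.partition_eq_of_isConj.2 (Nat.Partition.ext h')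
    obtain ⟨g, rfl⟩ := isConj_iff.1 hc
    exact factorizationCount_le_conj σ g ν
  exact le_antisymm (key h) (key h.symm)

/-- The connection coefficient `A[μ; ν₁, …, ν_i]`: the number of sequences `(σ₁, …, σ_i)` with
`π(σ_j) = ν_j` whose product is a given permutation of cycle partition `μ`
(by `factorizationCount_congr` it does not matter which one). -/
def connectionCoeff {k i : ℕ} (μ : Nat.Partition k) (ν : Fin i → Nat.Partition k) : ℕ :=
  factorizationCount (exists_cyclePartition_eq μ).choose ν

open Classical in
/-- `A[μ, i, h]`: the sum of the `A[μ; ν₁, …, ν_i]` over all `ν_j ≠ 1^k` with `∑ |ν_j| = h`. -/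
def coeffSum {k : ℕ} (μ : Nat.Partition k) (i h : ℕ) : ℕ :=
  ∑ ν : Fin i → Nat.Partition k with
    (∀ j, (ν j).parts ≠ Multiset.replicate k 1) ∧ ∑ j, size (ν j) = h,
    connectionCoeff μ ν

/-- `A[μ, h] = ∑_i (-1)^i A[μ, i, h]`. The term `i = 0` (the empty product) is nonzero only for
`μ = 1^k` and `h = 0`. -/
def expansionCoeff {k : ℕ} (μ : Nat.Partition k) (h : ℕ) : ℤ :=
  ∑ i ∈ Finset.range (h + 1), (-1) ^ i * (coeffSum μ i h : ℤ)

/-- `C[μ] = A[μ, |μ|]`. -/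
def leadingCoeff {k : ℕ} (μ : Nat.Partition k) : ℤ := expansionCoeff μ (size μ)

/-- The Young subgroup of a decomposition of `{1, …, k}` into blocks: the permutations which map
every block to itself. -/
def youngSubgroup {k : ℕ} (r : Setoid (Fin k)) : Subgroup (Equiv.Perm (Fin k)) where
  carrier := {τ | ∀ x, r x (τ x)}
  one_mem' := fun x => r.refl x
  mul_mem' := fun {a b} ha hb x => r.trans (hb x) (ha (b x))
  inv_mem' := fun {a} ha x => r.symm (by simpa using ha (a⁻¹ x))

end Weingarten

end

noncomputable section

namespace Weingarten

open Equiv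

/-! The space of `σ`-invariant functions on `Fin k` has dimension `c(σ)`, hence codimension `|σ|`.
Functions invariant under `σ` and `τ` are invariant under `στ`, so length is subadditive. Equality
forces the invariants of the product to be exactly the common invariants (`invariants_mul_le`);
testing this on the indicator of a cycle gives the Young subgroup statement.

For the limit, the cycle element is invertible because it is a product of factors `d` + Jucys–Murphy
element (`cycleElement_succ`). Put `z = d⁻¹`. The equations for the rescaled values `d ^ (k + |σ|)
Wg(d, σ)` have the matrix `z ^ (|στ⁻¹| + |τ| - |σ|)`, polynomial in `z` and, at `z = 0`,
unitriangular with respect to length. So the limit exists and is the unique solution at `z = 0`.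
Splitting off the first factor of a factorization shows that `C` solves that system
(`sum_leadingCoeff`).

The same factorization gives `d Wg(σ) + ∑ Wg(σ (0 p)) = 0` when `σ` moves `0`. In the limit only the
`p` in the cycle of `0` survive, and these transpositions cut that cycle in two. This is the Catalan
recursion with signs, so induction on length makes `C` a product of signed Catalan numbers over the
cycles. Both the full-cycle value and multiplicativity follow. -/

/-! ### Cycle counts and length -/

theorem numCycles_eq_card_cycleType {k : ℕ} (σ : Perm (Fin k)) :
    numCycles σ = σ.cycleType.card + (k - σ.support.card) := by
  simp [numCycles, height, cyclePartition, Perm.parts_partition]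

theorem support_card_le {k : ℕ} (σ : Perm (Fin k)) : σ.support.card ≤ k := by
  simpa using Finset.card_le_univ σ.support

theorem card_cycleType_le_support_card {k : ℕ} (σ : Perm (Fin k)) :
    σ.cycleType.card ≤ σ.support.card := by
  rw [← σ.sum_cycleType]
  have h := Multiset.card_nsmul_le_sum (s := σ.cycleType) (a := 1)
    (fun a ha => (Perm.one_lt_of_mem_cycleType ha).le)
  simpa using h

theorem numCycles_add_length {k : ℕ} (σ : Perm (Fin k)) : numCycles σ + length σ = k := by
  have h1 := support_card_le σ
  have h2 := card_cycleType_le_support_card σ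
  have h3 := numCycles_eq_card_cycleType σ
  have h4 : length σ = k - numCycles σ := rfl
  omega

theorem length_add_card_cycleType {k : ℕ} (σ : Perm (Fin k)) :
    length σ + σ.cycleType.card = σ.support.card := by
  have h1 := support_card_le σ
  have h2 := card_cycleType_le_support_card σ
  have h3 := numCycles_eq_card_cycleType σ
  have h4 := numCycles_add_length σ
  omega

theorem length_eq_sum_cycleType {k : ℕ} (σ : Perm (Fin k)) :
    length σ = (σ.cycleType.map fun a => a - 1).sum := by
  have h : (σ.cycleType.map fun a => a - 1).sum + σ.cycleType.card = σ.cycleType.sum := by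
    have h0 : (σ.cycleType.map fun a => (a - 1) + 1) = σ.cycleType.map id :=
      Multiset.map_congr rfl fun a ha =>
        Nat.sub_add_cancel (Perm.one_lt_of_mem_cycleType ha).le
    have h1 := congrArg Multiset.sum h0
    simpa [Multiset.sum_map_add] using h1
  have h2 := length_add_card_cycleType σ
  rw [Perm.sum_cycleType] at h
  omega

@[simp]
theorem length_one {k : ℕ} : length (1 : Perm (Fin k)) = 0 := by
  simp [length_eq_sum_cycleType]

theorem length_eq_zero_iff {k : ℕ} {σ : Perm (Fin k)} : length σ = 0 ↔ σ = 1 := by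
  refine ⟨fun h => ?_, fun h => h ▸ length_one⟩
  rw [length_eq_sum_cycleType, Multiset.sum_eq_zero_iff] at h
  rw [← Perm.cycleType_eq_zero, Multiset.eq_zero_iff_forall_notMem]
  intro a ha
  have h1 := h (a - 1) (Multiset.mem_map_of_mem _ ha)
  have h2 := Perm.one_lt_of_mem_cycleType ha
  omega

theorem length_pos {k : ℕ} {σ : Perm (Fin k)} (h : σ ≠ 1) : 0 < length σ :=
  Nat.pos_of_ne_zero fun h0 => h (length_eq_zero_iff.1 h0)

theorem cyclePartition_eq_iff {k : ℕ} {σ τ : Perm (Fin k)} :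
    cyclePartition σ = cyclePartition τ ↔ σ.cycleType = τ.cycleType := by
  rw [← Perm.isConj_iff_cycleType_eq, Perm.partition_eq_of_isConj, Nat.Partition.ext_iff,
    Nat.Partition.ext_iff]
  rfl

theorem length_congr {k : ℕ} {σ τ : Perm (Fin k)} (h : σ.cycleType = τ.cycleType) :
    length σ = length τ := by
  rw [length_eq_sum_cycleType, h, length_eq_sum_cycleType]

theorem sign_eq_neg_one_pow_length {k : ℕ} (σ : Perm (Fin k)) :
    Perm.sign σ = (-1) ^ length σ := by
  rw [Perm.sign_of_cycleType, Perm.sum_cycleType, ← length_add_card_cycleType, add_assoc, pow_add,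
    ← two_mul, pow_mul (-1) 2]
  simp

/-! ### Invariant functions and length-additive products -/

/-- The rational functions on `Fin k` invariant under `σ`. -/
def invariants {k : ℕ} (σ : Perm (Fin k)) : Submodule ℚ (Fin k → ℚ) where
  carrier := {f | ∀ x, f (σ x) = f x}
  add_mem' := fun ha hb x => by simp [ha x, hb x]
  zero_mem' := fun _ => rfl
  smul_mem' := fun c f hf x => by simp [hf x]

theorem mem_invariants_iff_sameCycle {k : ℕ} {σ : Perm (Fin k)} {f : Fin k → ℚ} :
    f ∈ invariants σ ↔ ∀ x y, σ.SameCycle x y → f x = f y := by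
  refine ⟨fun h x y hxy => ?_,
    fun h x => (h x (σ x) (Perm.sameCycle_apply_right.2 (.refl _ _))).symm⟩
  obtain ⟨n, rfl⟩ := hxy.exists_nat_pow_eq
  induction n with
  | zero => rfl
  | succ n ih =>
    rw [pow_succ', Perm.mul_apply, h]
    exact ih ⟨n, by simp⟩

-- The map `φ` sends a fixed point to itself and a moved point to its cycle factor. Its fibres are
-- the orbits, and its image is the cycle factors together with the fixed points.
open Classical in
theorem card_quotient_sameCycle {k : ℕ} (σ : Perm (Fin k)) :
    Nat.card (Quotient (Perm.SameCycle.setoid σ)) = numCycles σ := by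
  let φ : Fin k → Perm (Fin k) ⊕ Fin k := fun x => if σ x = x then .inr x else .inl (σ.cycleOf x)
  have hker : ∀ x y, φ x = φ y ↔ σ.SameCycle x y := by
    intro x y
    by_cases hx : σ x = x <;> by_cases hy : σ y = y
    · simp only [φ, hx, hy, if_true, Sum.inr.injEq]
      exact ⟨fun h => h ▸ .refl _ _, fun h => h.eq_of_left hx⟩
    · simp only [φ, hx, hy, if_true, if_false, reduceCtorEq, false_iff]
      exact fun h => hy (h.apply_eq_self_iff.1 hx)
    · simp only [φ, hx, hy, if_true, if_false, reduceCtorEq, false_iff]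
      exact fun h => hx (h.apply_eq_self_iff.2 hy)
    · simp only [φ, hx, hy, if_false, Sum.inl.injEq]
      exact (Perm.sameCycle_iff_cycleOf_eq_of_mem_support (Perm.mem_support.2 hx)
        (Perm.mem_support.2 hy)).symm
  have himg : Finset.univ.image φ = σ.cycleFactorsFinset.disjSum σ.supportᶜ := by
    ext (c | x)
    · simp only [Finset.mem_image, Finset.mem_univ, true_and, Finset.inl_mem_disjSum]
      constructor
      · rintro ⟨x, hx⟩
        by_cases h : σ x = x
        · simp [φ, h] at hx
        · simp only [φ, h, if_false, Sum.inl.injEq] at hx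
          rw [← hx]
          exact Perm.cycleOf_mem_cycleFactorsFinset_iff.2 (Perm.mem_support.2 h)
      · intro hc
        obtain ⟨x, hx⟩ := (Perm.mem_cycleFactorsFinset_iff.1 hc).1.nonempty_support
        have h := Perm.mem_cycleFactorsFinset_support_le hc hx
        refine ⟨x, ?_⟩
        simp only [φ, Perm.mem_support.1 h, if_false]
        rw [Perm.cycle_is_cycleOf hx hc]
    · simp only [Finset.mem_image, Finset.mem_univ, true_and, Finset.inr_mem_disjSum,
        Finset.mem_compl, Perm.mem_support, not_not]
      constructor
      · rintro ⟨y, hy⟩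
        by_cases h : σ y = y
        · simp only [φ, h, if_true, Sum.inr.injEq] at hy
          rwa [← hy]
        · simp [φ, h] at hy
      · exact fun h => ⟨x, by simp [φ, h]⟩
  have hs : Perm.SameCycle.setoid σ = Setoid.ker φ := by
    ext x y
    exact (hker x y).symm
  rw [hs, Nat.card_congr (Setoid.quotientKerEquivRange φ), numCycles_eq_card_cycleType]
  have hr : Set.range φ = ((Finset.univ.image φ : Finset _) : Set _) := by simp
  rw [hr, himg, Nat.card_eq_card_toFinset, Finset.toFinset_coe, Finset.card_disjSum,
    Finset.card_compl, Fintype.card_fin]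
  congr 1
  simp [Perm.cycleType_def]

theorem finrank_invariants {k : ℕ} (σ : Perm (Fin k)) :
    Module.finrank ℚ (invariants σ) = numCycles σ := by
  classical
  let e : invariants σ ≃ₗ[ℚ] (Quotient (Perm.SameCycle.setoid σ) → ℚ) :=
    { toFun := fun f q => Quotient.liftOn q f.1 (mem_invariants_iff_sameCycle.1 f.2)
      map_add' := fun f g => by ext ⟨x⟩; rfl
      map_smul' := fun c f => by ext ⟨x⟩; rfl
      invFun := fun g => ⟨fun x => g ⟦x⟧, fun x => congrArg g
        (Quotient.sound (Perm.sameCycle_apply_left.2 (Perm.SameCycle.refl σ x)))⟩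
      left_inv := fun f => by ext x; rfl
      right_inv := fun g => by ext ⟨x⟩; rfl }
  rw [e.finrank_eq, Module.finrank_fintype_fun_eq_card, ← Nat.card_eq_fintype_card,
    card_quotient_sameCycle]

theorem le_finrank_inf_add {k : ℕ} (U V : Submodule ℚ (Fin k → ℚ)) :
    Module.finrank ℚ U + Module.finrank ℚ V ≤ Module.finrank ℚ (U ⊓ V : Submodule ℚ _) + k := by
  have h := Submodule.finrank_sup_add_finrank_inf_eq U V
  have h2 := Submodule.finrank_le (U ⊔ V)
  rw [Module.finrank_fin_fun] at h2
  omega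

theorem invariants_inf_le_mul {k : ℕ} (σ τ : Perm (Fin k)) :
    invariants σ ⊓ invariants τ ≤ invariants (σ * τ) := fun f hf x => by
  rw [Perm.mul_apply, hf.1, hf.2]

theorem length_mul_le {k : ℕ} (σ τ : Perm (Fin k)) : length (σ * τ) ≤ length σ + length τ := by
  have h1 := le_finrank_inf_add (invariants σ) (invariants τ)
  have h2 := Submodule.finrank_mono (invariants_inf_le_mul σ τ)
  simp only [finrank_invariants] at h1 h2
  have := numCycles_add_length σ
  have := numCycles_add_length τ
  have := numCycles_add_length (σ * τ)
  omega

/-- The intersection has dimension at least `c(σ) + c(τ) - k`, which under additivity is `c(στ)`;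
being contained in the invariants of `στ`, it fills them. -/
theorem invariants_mul_le {k : ℕ} {σ τ : Perm (Fin k)}
    (h : length (σ * τ) = length σ + length τ) :
    invariants (σ * τ) ≤ invariants σ ⊓ invariants τ := by
  have h1 := le_finrank_inf_add (invariants σ) (invariants τ)
  have := numCycles_add_length σ
  have := numCycles_add_length τ
  have := numCycles_add_length (σ * τ)
  refine (Submodule.eq_of_le_of_finrank_le (invariants_inf_le_mul σ τ) ?_).ge
  simp only [finrank_invariants] at h1 ⊢
  omega

theorem length_prod_le {k : ℕ} (l : List (Perm (Fin k))) :
    length l.prod ≤ (l.map length).sum := by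
  induction l with
  | nil => simp
  | cons τ l ih =>
    have := length_mul_le τ l.prod
    simp only [List.prod_cons, List.map_cons, List.sum_cons]
    omega

theorem invariants_prod_le {k : ℕ} {l : List (Perm (Fin k))}
    (h : (l.map length).sum = length l.prod) :
    ∀ τ ∈ l, invariants l.prod ≤ invariants τ := by
  induction l with
  | nil => simp
  | cons ρ l ih =>
    have h1 := length_mul_le ρ l.prod
    have h2 := length_prod_le l
    simp only [List.prod_cons, List.map_cons, List.sum_cons] at h ⊢
    have h3 := invariants_mul_le (σ := ρ) (τ := l.prod) (by omega)
    intro τ hτ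
    rcases List.mem_cons.1 hτ with rfl | hτ
    · exact h3.trans inf_le_left
    · exact (h3.trans inf_le_right).trans (ih (by omega) τ hτ)

theorem sameCycle_apply_of_invariants_le {k : ℕ} {σ τ : Perm (Fin k)}
    (h : invariants σ ≤ invariants τ) (x : Fin k) : σ.SameCycle x (τ x) := by
  classical
  -- The indicator of the cycle of `x` is the test function.
  have hf : (fun y => if σ.SameCycle x y then (1 : ℚ) else 0) ∈ invariants σ := fun y => by
    simp only [Perm.sameCycle_apply_right]
  have h1 := h hf x
  by_contra hx
  simp only [hx, if_false, Perm.SameCycle.refl, if_true] at h1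
  exact one_ne_zero h1.symm

theorem mem_youngSubgroup_of_length_prod {k : ℕ} {l : List (Perm (Fin k))}
    (h : (l.map length).sum = length l.prod) :
    ∀ τ ∈ l, τ ∈ youngSubgroup (Perm.SameCycle.setoid l.prod) :=
  fun τ hτ x => sameCycle_apply_of_invariants_le (invariants_prod_le h τ hτ) x

/-! ### Cutting and joining cycles by a transposition -/

theorem formPerm_append_cons {α : Type*} [DecidableEq α] (l₁ l₂ : List α) (y : α) :
    (l₁ ++ y :: l₂).formPerm = (l₁ ++ [y]).formPerm * (y :: l₂).formPerm := by
  induction l₁ with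
  | nil => simp
  | cons a l ih =>
    cases l with
    | nil => simp
    | cons b l =>
      simp only [List.cons_append, List.formPerm_cons_cons] at ih ⊢
      rw [ih, mul_assoc]

theorem swap_mul_formPerm {α : Type*} [DecidableEq α] (l₁ l₂ : List α) (x y : α)
    (h : (x :: (l₁ ++ y :: l₂)).Nodup) :
    swap x y * (x :: (l₁ ++ y :: l₂)).formPerm = (x :: l₁).formPerm * (y :: l₂).formPerm := by
  have h1 := formPerm_append_cons (x :: l₁) l₂ y
  have hn : (y :: x :: l₁).Nodup := by
    simp only [List.nodup_cons, List.nodup_append, List.mem_append, List.mem_cons] at h ⊢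
    grind
  have h2 : (x :: l₁ ++ [y]).formPerm = (y :: x :: l₁).formPerm := by
    simpa using List.formPerm_rotate_one (y :: x :: l₁) hn
  rw [List.cons_append] at h1
  rw [h1, h2, List.formPerm_cons_cons, mul_assoc, swap_comm y x, ← mul_assoc, swap_mul_self,
    one_mul]

/-- `cycleType` omits fixed points, hence the case distinction for lists with fewer than two
entries. -/
theorem cycleType_formPerm_mul {α : Type*} [DecidableEq α] [Fintype α] {l : List α} {ρ : Perm α}
    (hl : l.Nodup) (hρ : ∀ z ∈ l, ρ z = z) :
    (l.formPerm * ρ).cycleType = (if 2 ≤ l.length then {l.length} else 0) + ρ.cycleType := by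
  have hd : l.formPerm.Disjoint ρ := fun z => by
    by_cases hz : z ∈ l
    · exact .inr (hρ z hz)
    · exact .inl (List.formPerm_apply_of_notMem hz)
  rw [hd.cycleType_mul]
  congr 1
  split_ifs with h
  · rw [(List.isCycle_formPerm hl h).cycleType, List.support_formPerm_of_nodup l hl
      (fun x hx => by simp [hx] at h), List.toFinset_card_of_nodup hl]
  · rw [(List.formPerm_eq_one_iff l hl).2 (by omega), Perm.cycleType_one]

/-- The cycle through a moved point `x`, split off as a cyclically ordered list. -/
theorem exists_eq_formPerm_mul {α : Type*} [DecidableEq α] [Fintype α] {σ : Perm α} {x : α}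
    (hx : σ x ≠ x) : ∃ (t : List α) (ρ : Perm α), (x :: t).Nodup ∧
      (∀ j, j ∈ t ↔ j ≠ x ∧ σ.SameCycle x j) ∧ σ = (x :: t).formPerm * ρ ∧
      ∀ z ∈ x :: t, ρ z = z := by
  have hxs := Perm.mem_support.2 hx
  have hlen := Perm.length_toList_pos_of_mem_support σ x hxs
  have h0 := Perm.toList_getElem_zero σ x hxs
  have hmem := fun j => Perm.mem_toList_iff (p := σ) (x := x) (y := j)
  have hnd := Perm.nodup_toList σ x
  have hf := Perm.formPerm_toList σ x
  rcases htl : Perm.toList σ x with _ | ⟨a, t⟩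
  · simp [htl] at hlen
  · simp only [htl, List.getElem_cons_zero] at h0 hmem hnd hf
    subst h0
    refine ⟨t, (σ.cycleOf a)⁻¹ * σ, hnd, fun j => ?_, by rw [hf]; group, fun z hz => ?_⟩
    · have h1 := hmem j
      rw [List.nodup_cons] at hnd
      rw [List.mem_cons] at h1
      constructor
      · exact fun h => ⟨fun hj => hnd.1 (hj ▸ h), (h1.1 (.inr h)).1⟩
      · exact fun h => (h1.2 ⟨h.2, hxs⟩).resolve_left h.1
    · have hs := ((hmem z).1 hz).1
      rw [Perm.mul_apply, Perm.inv_eq_iff_eq, hs.cycleOf_apply]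

/-- The cycle is cut just before `t[i]`: `x` keeps the `i` entries before it, and `t[i]` starts a
cycle of the remaining `t.length - i` entries. -/
theorem cycleType_swap_mul {α : Type*} [DecidableEq α] [Fintype α] {t : List α} {x : α}
    {ρ : Perm α} (hl : (x :: t).Nodup) (hρ : ∀ z ∈ x :: t, ρ z = z) (i : Fin t.length) :
    (swap x t[i] * ((x :: t).formPerm * ρ)).cycleType =
      (if 2 ≤ (i : ℕ) + 1 then {(i : ℕ) + 1} else 0) +
      ((if 2 ≤ t.length - i then {t.length - i} else 0) + ρ.cycleType) := by
  have ht : t = t.take i ++ t[i] :: t.drop (i + 1) := by simp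
  have hi : (i : ℕ) < t.length := i.2
  have hl' := hl
  have hρ' := hρ
  rw [ht] at hl' hρ'
  have h1 := swap_mul_formPerm _ _ _ _ hl'
  rw [← ht] at h1
  have hn1 : (x :: t.take i).Nodup := hl'.sublist (by simp [List.take_sublist])
  have hn2 : (t[i] :: t.drop (i + 1)).Nodup :=
    hl'.sublist ((List.sublist_append_right _ _).trans (List.sublist_cons_self _ _))
  have hdis : ∀ z ∈ x :: t.take i, z ∉ t[i] :: t.drop (i + 1) := by
    rw [← List.cons_append, List.nodup_append] at hl'
    intro z hz hz'
    exact hl'.2.2 z hz z hz' rfl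
  rw [← mul_assoc, h1, mul_assoc, cycleType_formPerm_mul hn1, cycleType_formPerm_mul hn2]
  · have h2 : (t[i] :: t.drop (i + 1)).length = t.length - i := by
      simp only [List.length_cons, List.length_drop]; omega
    have h3 : (x :: t.take i).length = i + 1 := by simp
    rw [h2, h3]
  · exact fun z hz => hρ' z (List.mem_cons_of_mem _ (List.mem_append_right _ hz))
  · intro z hz
    rw [Perm.mul_apply, hρ' z (by simp only [List.mem_cons, List.mem_append] at hz ⊢; tauto),
      List.formPerm_apply_of_notMem (hdis z hz)]

theorem length_swap_le {k : ℕ} (x y : Fin k) : length (swap x y) ≤ 1 := by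
  rcases eq_or_ne x y with rfl | h
  · simp [← Perm.one_def]
  · rw [length_eq_sum_cycleType, Perm.isSwap_iff_cycleType.1 ⟨x, y, h, rfl⟩]
    simp

theorem length_swap_mul_of_sameCycle {k : ℕ} {σ : Perm (Fin k)} {x y : Fin k} (hxy : x ≠ y)
    (h : σ.SameCycle x y) : length (swap x y * σ) + 1 = length σ := by
  have hx : σ x ≠ x := fun hx => hxy (h.eq_of_left hx)
  obtain ⟨t, ρ, hl, hmem, rfl, hρ⟩ := exists_eq_formPerm_mul hx
  obtain ⟨i, hi, rfl⟩ := List.mem_iff_getElem.1 ((hmem y).2 ⟨hxy.symm, h⟩)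
  have h1 := cycleType_swap_mul hl hρ ⟨i, hi⟩
  simp only [Fin.getElem_fin] at h1
  rw [length_eq_sum_cycleType, length_eq_sum_cycleType, h1, cycleType_formPerm_mul hl hρ]
  split_ifs <;> simp_all <;> omega

/-- The length grows by at most one, and parity of the sign forbids equality. A drop would make `σ =
swap x y * (swap x y * σ)` length-additive, so the transposition would preserve the cycles of `σ`,
putting `y` in the cycle of `x`. -/
theorem length_swap_mul_of_not_sameCycle {k : ℕ} {σ : Perm (Fin k)} {x y : Fin k}
    (h : ¬ σ.SameCycle x y) : length (swap x y * σ) = length σ + 1 := by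
  have hxy : x ≠ y := fun hxy => h (hxy ▸ .refl _ _)
  have h1 := length_mul_le (swap x y) σ
  have h2 := length_swap_le x y
  have h3 := length_mul_le (swap x y) (swap x y * σ)
  have h4 : swap x y * (swap x y * σ) = σ := by rw [← mul_assoc, swap_mul_self, one_mul]
  have h5 : length (swap x y * σ) ≠ length σ := fun h5 => by
    have h6 := sign_eq_neg_one_pow_length (swap x y * σ)
    rw [h5, ← sign_eq_neg_one_pow_length, Perm.sign_mul, Perm.sign_swap hxy] at h6
    rcases Int.units_eq_one_or (Perm.sign σ) with h7 | h7 <;> rw [h7] at h6 <;> revert h6 <;> decide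
  have h6 : ¬ length (swap x y * σ) < length σ := fun h6 => by
    refine h ?_
    have h7 := invariants_mul_le (σ := swap x y) (τ := swap x y * σ) (by rw [h4] at h3 ⊢; omega)
    rw [h4] at h7
    simpa using sameCycle_apply_of_invariants_le (h7.trans inf_le_left) x
  omega

/-! ### Signed Catalan products -/

/-- The signed Catalan number `(-1) ^ (a - 1) C_{a-1}`, the value expected on an `a`-cycle. -/
def signedCatalan (a : ℕ) : ℤ := (-1) ^ (a - 1) * (catalan (a - 1) : ℤ)

@[simp]
theorem signedCatalan_one : signedCatalan 1 = 1 := by simp [signedCatalan]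

theorem sum_signedCatalan {n : ℕ} (hn : 1 ≤ n) :
    ∑ i : Fin n, signedCatalan (i + 1) * signedCatalan (n - i) = - signedCatalan (n + 1) := by
  obtain ⟨n, rfl⟩ := Nat.exists_eq_add_of_le' hn
  simp only [signedCatalan, Nat.add_sub_cancel, catalan_succ]
  push_cast
  rw [Finset.mul_sum, ← Finset.sum_neg_distrib]
  refine Finset.sum_congr rfl fun i _ => ?_
  have hi := i.2
  have h1 : n + 1 - (i : ℕ) - 1 = n - i := by omega
  have h2 : (-1 : ℤ) ^ (n + 1) = - ((-1) ^ (i : ℕ) * (-1) ^ (n - (i : ℕ))) := by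
    rw [← pow_add, pow_succ, Nat.add_sub_cancel' (by omega)]; ring
  rw [h1, h2]
  ring

/-- The product of the signed Catalan numbers over the cycles. -/
def catalanValue {k : ℕ} (σ : Perm (Fin k)) : ℤ := (σ.cycleType.map signedCatalan).prod

theorem prod_map_signedCatalan_ite (n : ℕ) (hn : 1 ≤ n) (s : Multiset ℕ) :
    (((if 2 ≤ n then {n} else 0) + s).map signedCatalan).prod =
      signedCatalan n * (s.map signedCatalan).prod := by
  split_ifs with h
  · simp
  · obtain rfl : n = 1 := by omega
    simp

/-- As `j` runs through the rest of the cycle of `x`, the cut yields every ordered pair of positive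
lengths with the right sum exactly once; the other cycles contribute a common factor. -/
theorem sum_catalanValue_swap_mul {k : ℕ} {σ : Perm (Fin k)} {x : Fin k} (hx : σ x ≠ x)
    [DecidablePred fun j => j ≠ x ∧ σ.SameCycle x j] :
    ∑ j with j ≠ x ∧ σ.SameCycle x j, catalanValue (swap x j * σ) = - catalanValue σ := by
  obtain ⟨t, ρ, hl, hmem, hσ, hρ⟩ := exists_eq_formPerm_mul hx
  have hset : Finset.univ.filter (fun j => j ≠ x ∧ σ.SameCycle x j) = t.toFinset := by
    ext j
    simp [hmem]
  have htn : t ≠ [] := fun h => hx <| by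
    rw [hσ, h, Perm.mul_apply, hρ x (by simp)]
    simp
  have ht1 : 1 ≤ t.length := List.length_pos_iff.2 htn
  rw [hset, List.sum_toFinset _ (List.nodup_cons.1 hl).2, ← Fin.sum_univ_fun_getElem]
  have hterm : ∀ i : Fin t.length, catalanValue (swap x t[i] * σ) =
      signedCatalan (i + 1) * signedCatalan (t.length - i) *
        (ρ.cycleType.map signedCatalan).prod := fun i => by
    rw [catalanValue, hσ, cycleType_swap_mul hl hρ, prod_map_signedCatalan_ite _ (by omega),
      prod_map_signedCatalan_ite _ (by omega), mul_assoc]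
  have h0 : catalanValue σ = signedCatalan (t.length + 1) *
      (ρ.cycleType.map signedCatalan).prod := by
    rw [catalanValue, hσ, cycleType_formPerm_mul hl hρ, prod_map_signedCatalan_ite _ (by simp),
      List.length_cons]
  rw [h0, ← neg_mul, ← sum_signedCatalan ht1, Finset.sum_mul]
  exact Finset.sum_congr rfl fun i _ => hterm i

/-! ### Jucys–Murphy factorization, invertibility and the recursion for `Wg` -/

/-- The embedding of the permutations of `Fin k` as the permutations of `Fin (k + 1)` fixing `0`. -/
def succEmbedding (k : ℕ) : Perm (Fin k) →* Perm (Fin (k + 1)) :=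
  Perm.extendDomainHom (finSuccAboveEquiv 0)

theorem succEmbedding_apply_zero {k : ℕ} (e : Perm (Fin k)) : succEmbedding k e 0 = 0 :=
  Perm.extendDomain_apply_not_subtype _ _ (by simp)

theorem succEmbedding_apply_succ {k : ℕ} (e : Perm (Fin k)) (x : Fin k) :
    succEmbedding k e x.succ = (e x).succ := by
  have h (y : Fin k) : (finSuccAboveEquiv (0 : Fin (k + 1)) y : Fin (k + 1)) = y.succ := rfl
  rw [← h, ← h]
  exact Perm.extendDomain_apply_image e (finSuccAboveEquiv (0 : Fin (k + 1))) x

theorem decomposeFin_symm_eq {k : ℕ} (p : Fin (k + 1)) (e : Perm (Fin k)) :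
    Perm.decomposeFin.symm (p, e) = swap 0 p * succEmbedding k e := by
  ext x : 1
  refine Fin.cases ?_ (fun x => ?_) x
  · simp [succEmbedding_apply_zero]
  · simp [succEmbedding_apply_succ]

theorem length_succEmbedding {k : ℕ} (e : Perm (Fin k)) :
    length (succEmbedding k e) = length e := by
  rw [length_eq_sum_cycleType, length_eq_sum_cycleType]
  congr 2
  exact Perm.cycleType_extendDomain _

theorem numCycles_succEmbedding {k : ℕ} (e : Perm (Fin k)) :
    numCycles (succEmbedding k e) = numCycles e + 1 := by
  have h1 := numCycles_add_length e
  have h2 := numCycles_add_length (succEmbedding k e)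
  rw [length_succEmbedding] at h2
  omega

theorem numCycles_swap_mul_succEmbedding {k : ℕ} (p : Fin k) (e : Perm (Fin k)) :
    numCycles (swap 0 p.succ * succEmbedding k e) = numCycles e := by
  have h1 := numCycles_add_length e
  have h2 := numCycles_add_length (swap 0 p.succ * succEmbedding k e)
  rw [length_swap_mul_of_not_sameCycle, length_succEmbedding] at h2
  · omega
  · exact fun h => (Fin.succ_ne_zero p) (h.eq_of_left (succEmbedding_apply_zero e)).symm

/-- `d` plus the Jucys–Murphy element of `S_{k+1}` for the point `0`. -/
def jucysMurphyFactor (k : ℕ) (d : ℝ) : MonoidAlgebra ℝ (Perm (Fin (k + 1))) :=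
  MonoidAlgebra.single 1 d + ∑ p : Fin k, MonoidAlgebra.single (swap 0 p.succ) 1

/-- Each permutation is uniquely `swap 0 p` times one fixing `0`. For `p = 0` the point `0` is an
extra cycle, giving the factor `d`; otherwise it joins an existing cycle and the count is that in
`S_k`. -/
theorem cycleElement_succ (k : ℕ) (d : ℝ) :
    cycleElement (k + 1) d =
      jucysMurphyFactor k d * MonoidAlgebra.mapDomainRingHom ℝ (succEmbedding k)
        (cycleElement k d) := by
  rw [cycleElement, ← Equiv.sum_comp Perm.decomposeFin.symm, Fintype.sum_prod_type,
    Fin.sum_univ_succ, jucysMurphyFactor, add_mul, cycleElement, map_sum, Finset.mul_sum,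
    Finset.sum_mul]
  simp only [decomposeFin_symm_eq, Finset.mul_sum, MonoidAlgebra.mapDomainRingHom_apply,
    MonoidAlgebra.mapDomain_single, MonoidAlgebra.single_mul_single, one_mul,
    numCycles_swap_mul_succEmbedding, swap_self, ← Perm.one_def, numCycles_succEmbedding, pow_succ']

theorem isUnit_of_mul_left_injective {A : Type*} [Ring A] [Algebra ℝ A] [FiniteDimensional ℝ A]
    {a : A} (h : ∀ x, a * x = 0 → x = 0) : IsUnit a := by
  have hinj : Function.Injective (LinearMap.mulLeft ℝ a) :=
    (injective_iff_map_eq_zero _).2 h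
  obtain ⟨b, hb⟩ := LinearMap.injective_iff_surjective.1 hinj 1
  have hb : a * b = 1 := hb
  refine ⟨⟨a, b, hb, hinj ?_⟩, rfl⟩
  change a * (b * a) = a * 1
  rw [← mul_assoc, hb, one_mul, mul_one]

/-- Diagonal dominance: at a coefficient of largest modulus of an element killed by the factor, `d`
times it equals minus a sum of `k` coefficients, impossible for `d > k` unless all vanish. -/
theorem isUnit_jucysMurphyFactor {k : ℕ} {d : ℝ} (hd : (k : ℝ) < d) :
    IsUnit (jucysMurphyFactor k d) := by
  have : FiniteDimensional ℝ (MonoidAlgebra ℝ (Perm (Fin (k + 1)))) :=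
    Module.Finite.equiv (MonoidAlgebra.coeffLinearEquiv ℝ).symm
  refine isUnit_of_mul_left_injective fun f hf => ?_
  obtain ⟨g, -, hg⟩ := Finset.exists_max_image Finset.univ (fun g => |f.coeff g|)
    ⟨1, Finset.mem_univ _⟩
  have h0 := congrArg (fun x => MonoidAlgebra.coeff x g) hf
  simp only [jucysMurphyFactor, add_mul, Finset.sum_mul, MonoidAlgebra.coeff_add,
    MonoidAlgebra.coeff_sum, Finsupp.add_apply, Finsupp.finsetSum_apply,
    MonoidAlgebra.coeff_single_mul_apply, MonoidAlgebra.coeff_zero, Finsupp.zero_apply, inv_one,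
    one_mul] at h0
  have h1 : d * |f.coeff g| ≤ k * |f.coeff g| := by
    have hk : (0 : ℝ) ≤ k := k.cast_nonneg
    calc d * |f.coeff g| = |d * f.coeff g| := by rw [abs_mul, abs_of_pos (hk.trans_lt hd)]
      _ = |∑ p : Fin k, f.coeff ((swap 0 p.succ)⁻¹ * g)| := by
        rw [eq_neg_of_add_eq_zero_left h0, abs_neg]
      _ ≤ ∑ p : Fin k, |f.coeff ((swap 0 p.succ)⁻¹ * g)| := Finset.abs_sum_le_sum_abs _ _
      _ ≤ ∑ _p : Fin k, |f.coeff g| := Finset.sum_le_sum fun p _ => hg _ (Finset.mem_univ _)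
      _ = k * |f.coeff g| := by simp
  have h2 : |f.coeff g| ≤ 0 := by
    by_contra h2
    nlinarith
  ext x
  have h3 := (hg x (Finset.mem_univ _)).trans h2
  simpa using h3

theorem isUnit_cycleElement (k : ℕ) (d : ℝ) (hd : (k : ℝ) - 1 < d) :
    IsUnit (cycleElement k d) := by
  induction k with
  | zero =>
    have h : cycleElement 0 d = 1 := by
      rw [cycleElement, Fintype.sum_unique, MonoidAlgebra.one_def]
      congr 1
    rw [h]
    exact isUnit_one
  | succ k ih =>
    push_cast at hd
    rw [cycleElement_succ]
    exact (isUnit_jucysMurphyFactor (by linarith)).mul ((ih (by linarith)).map _)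

theorem inverse_cycleElement_mul_jucysMurphyFactor {k : ℕ} {d : ℝ} (hd : (k : ℝ) < d) :
    Ring.inverse (cycleElement (k + 1) d) * jucysMurphyFactor k d =
      MonoidAlgebra.mapDomainRingHom ℝ (succEmbedding k) (Ring.inverse (cycleElement k d)) := by
  have hu := isUnit_cycleElement k d (by linarith)
  have hu' := isUnit_cycleElement (k + 1) d (by push_cast; linarith)
  have h1 := Ring.inverse_mul_cancel _ hu'
  rw [cycleElement_succ, ← mul_assoc, ← cycleElement_succ] at h1
  refine (hu.map (MonoidAlgebra.mapDomainRingHom ℝ (succEmbedding k))).mul_right_cancel ?_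
  rw [h1, ← map_mul, Ring.inverse_mul_cancel _ hu, map_one]

/-- The inverse times the Jucys–Murphy factor is the embedded inverse from `S_k`, supported on
permutations fixing `0`. -/
theorem Wg_swap_recursion {k : ℕ} {d : ℝ} (hd : (k : ℝ) < d) {σ : Perm (Fin (k + 1))}
    (hσ : σ 0 ≠ 0) : d * Wg d σ + ∑ p : Fin k, Wg d (σ * swap 0 p.succ) = 0 := by
  have h := congrArg (fun x => MonoidAlgebra.coeff x σ)
    (inverse_cycleElement_mul_jucysMurphyFactor hd)
  have h0 : (MonoidAlgebra.mapDomainRingHom ℝ (succEmbedding k)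
      (Ring.inverse (cycleElement k d))).coeff σ = 0 := by
    rw [MonoidAlgebra.mapDomainRingHom_apply, MonoidAlgebra.coeff_mapDomain]
    refine Finsupp.mapDomain_of_notMem_range _ _ ?_
    rintro ⟨e, rfl⟩
    exact hσ (succEmbedding_apply_zero e)
  simp only [h0, jucysMurphyFactor, mul_add, Finset.mul_sum, MonoidAlgebra.coeff_add,
    MonoidAlgebra.coeff_sum, Finsupp.add_apply, Finsupp.finsetSum_apply,
    MonoidAlgebra.coeff_mul_single_apply, inv_one, mul_one, swap_inv] at h
  rw [mul_comm]
  exact h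

/-- The coefficientwise form of the equation defining `Wg`. -/
theorem sum_pow_numCycles_mul_Wg {k : ℕ} {d : ℝ} (hd : (k : ℝ) - 1 < d) (σ : Perm (Fin k)) :
    ∑ τ, d ^ numCycles (σ * τ⁻¹) * Wg d τ = if σ = 1 then 1 else 0 := by
  have h := congrArg (fun x => MonoidAlgebra.coeff x σ)
    (Ring.mul_inverse_cancel _ (isUnit_cycleElement k d hd))
  simp only [MonoidAlgebra.one_def, MonoidAlgebra.coeff_single, Finsupp.single_apply] at h
  rw [cycleElement, Finset.sum_mul] at h
  simp only [MonoidAlgebra.coeff_sum, Finsupp.finsetSum_apply,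
    MonoidAlgebra.coeff_single_mul_apply] at h
  simp only [eq_comm (a := σ)]
  rw [← h]
  refine Fintype.sum_equiv ((Equiv.inv _).trans (Equiv.mulLeft σ)) _ _ fun τ => ?_
  simp [Wg, cycleElement]

/-! ### Counting factorizations -/

open Classical in
/-- The number of factorizations of `σ` into `i` nontrivial permutations of total length `h`. -/
def nontrivialFactorizations {k : ℕ} (i h : ℕ) (σ : Perm (Fin k)) : ℕ :=
  ∑ s : Fin i → Perm (Fin k),
    if (∀ j, s j ≠ 1) ∧ ∑ j, length (s j) = h ∧ (List.ofFn s).prod = σ then 1 else 0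

theorem parts_cyclePartition_eq_replicate_iff {k : ℕ} {σ : Perm (Fin k)} :
    (cyclePartition σ).parts = Multiset.replicate k 1 ↔ σ = 1 := by
  have h : (cyclePartition (1 : Perm (Fin k))).parts = Multiset.replicate k 1 := by
    simp [cyclePartition, Perm.parts_partition]
  rw [← h, ← Nat.Partition.ext_iff, cyclePartition_eq_iff, Perm.cycleType_one,
    Perm.cycleType_eq_zero]

theorem connectionCoeff_cyclePartition {k i : ℕ} (σ : Perm (Fin k)) (ν : Fin i → k.Partition) :
    connectionCoeff (cyclePartition σ) ν = factorizationCount σ ν :=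
  factorizationCount_congr (exists_cyclePartition_eq (cyclePartition σ)).choose_spec ν

theorem coeffSum_cyclePartition {k : ℕ} (σ : Perm (Fin k)) (i h : ℕ) :
    coeffSum (cyclePartition σ) i h = nontrivialFactorizations i h σ := by
  classical
  rw [coeffSum, nontrivialFactorizations, ← Finset.card_filter,
    Finset.card_eq_sum_card_fiberwise (f := fun s j => cyclePartition (s j))
      (t := Finset.univ.filter fun ν : Fin i → k.Partition =>
        (∀ j, (ν j).parts ≠ Multiset.replicate k 1) ∧ ∑ j, size (ν j) = h)]
  · refine Finset.sum_congr (by congr) fun ν hν => ?_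
    rw [connectionCoeff_cyclePartition, factorizationCount, Nat.card_eq_fintype_card,
      Fintype.card_subtype, Finset.filter_filter]
    congr 1
    refine Finset.filter_congr fun s _ => ?_
    simp only [Finset.mem_filter, Finset.mem_univ, true_and] at hν
    constructor
    · rintro ⟨h1, h2⟩
      obtain rfl : (fun j => cyclePartition (s j)) = ν := funext h1
      exact ⟨⟨fun j hj => hν.1 j (parts_cyclePartition_eq_replicate_iff.2 hj), hν.2, h2⟩, rfl⟩
    · rintro ⟨⟨-, -, h2⟩, rfl⟩
      exact ⟨fun _ => rfl, h2⟩
  · intro s hs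
    simp only [Finset.coe_filter, Finset.mem_univ, true_and, Set.mem_ofPred_eq] at hs ⊢
    exact ⟨fun j hj => hs.1 j (parts_cyclePartition_eq_replicate_iff.1 hj), hs.2.1⟩

theorem nontrivialFactorizations_zero {k : ℕ} (σ : Perm (Fin k)) :
    nontrivialFactorizations 0 (length σ) σ = if σ = 1 then 1 else 0 := by
  simp only [nontrivialFactorizations, Fintype.sum_unique, IsEmpty.forall_iff, true_and,
    Finset.univ_eq_empty, Finset.sum_empty, List.ofFn_zero, List.prod_nil]
  by_cases h : σ = 1
  · simp [h]
  · simp [h, Ne.symm h]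

theorem nontrivialFactorizations_succ {k : ℕ} (i h : ℕ) (σ : Perm (Fin k)) :
    nontrivialFactorizations (i + 1) h σ = ∑ ρ : Perm (Fin k),
      if ρ ≠ 1 ∧ length ρ ≤ h then nontrivialFactorizations i (h - length ρ) (ρ⁻¹ * σ) else 0 := by
  classical
  simp only [nontrivialFactorizations]
  rw [← (Fin.consEquiv fun _ => Perm (Fin k)).sum_comp, Fintype.sum_prod_type]
  refine Finset.sum_congr rfl fun ρ _ => ?_
  split_ifs with hρ
  · refine Finset.sum_congr rfl fun s _ => ?_
    refine if_congr ?_ rfl rfl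
    have h1 : length ρ + ∑ j, length (s j) = h ↔ ∑ j, length (s j) = h - length ρ := by omega
    simp only [Fin.consEquiv_apply, Fin.forall_fin_succ, Fin.cons_zero, Fin.cons_succ,
      Fin.sum_univ_succ, List.ofFn_succ, List.prod_cons, h1, eq_inv_mul_iff_mul_eq]
    tauto
  · refine Finset.sum_eq_zero fun s _ => if_neg ?_
    simp only [Fin.consEquiv_apply, Fin.forall_fin_succ, Fin.cons_zero, Fin.cons_succ,
      Fin.sum_univ_succ]
    rintro ⟨⟨h1, -⟩, h2, -⟩
    exact hρ ⟨h1, by omega⟩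

theorem nontrivialFactorizations_eq_zero_of_lt {k : ℕ} {i h : ℕ} (hi : h < i) (σ : Perm (Fin k)) :
    nontrivialFactorizations i h σ = 0 := by
  refine Finset.sum_eq_zero fun s _ => if_neg ?_
  rintro ⟨h1, h2, -⟩
  have h3 : ∑ _j : Fin i, 1 ≤ ∑ j, length (s j) :=
    Finset.sum_le_sum fun j _ => length_pos (h1 j)
  simp only [Finset.sum_const, Finset.card_univ, Fintype.card_fin, smul_eq_mul, mul_one] at h3
  omega

theorem nontrivialFactorizations_eq_zero_of_lt_length {k : ℕ} {i h : ℕ} {σ : Perm (Fin k)}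
    (hσ : h < length σ) : nontrivialFactorizations i h σ = 0 := by
  refine Finset.sum_eq_zero fun s _ => if_neg ?_
  rintro ⟨-, h2, rfl⟩
  have h3 := length_prod_le (List.ofFn s)
  rw [List.map_ofFn, List.sum_ofFn] at h3
  simp only [Function.comp_apply] at h3
  omega

/-- Nontrivial factors have length at least one, so terms with `i > h` vanish. This allows one
common cutoff for different `h`. -/
theorem expansionCoeff_eq_sum_range {k : ℕ} (σ : Perm (Fin k)) {h N : ℕ} (hN : h + 1 ≤ N) :
    expansionCoeff (cyclePartition σ) h =
      ∑ i ∈ Finset.range N, (-1) ^ i * (nontrivialFactorizations i h σ : ℤ) := by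
  simp only [expansionCoeff, coeffSum_cyclePartition]
  refine Finset.sum_subset (Finset.range_subset_range.2 hN) fun i _ hi => ?_
  rw [Finset.mem_range, not_lt] at hi
  rw [nontrivialFactorizations_eq_zero_of_lt (by omega)]
  simp

theorem expansionCoeff_eq_zero_of_lt {k : ℕ} {σ : Perm (Fin k)} {h : ℕ} (hσ : h < length σ) :
    expansionCoeff (cyclePartition σ) h = 0 := by
  simp [expansionCoeff, coeffSum_cyclePartition, nontrivialFactorizations_eq_zero_of_lt_length hσ]

/-- `C[π(σ)]` satisfies the recursion of a Möbius function for the absolute order. -/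
theorem sum_leadingCoeff {k : ℕ} (σ : Perm (Fin k)) :
    ∑ τ : Perm (Fin k), (if length (σ * τ⁻¹) + length τ = length σ then
      leadingCoeff (cyclePartition τ) else 0) = if σ = 1 then 1 else 0 := by
  classical
  have hreindex : ∑ τ : Perm (Fin k), (if length (σ * τ⁻¹) + length τ = length σ then
      leadingCoeff (cyclePartition τ) else 0) =
      ∑ ρ : Perm (Fin k), (if length ρ + length (ρ⁻¹ * σ) = length σ then
        leadingCoeff (cyclePartition (ρ⁻¹ * σ)) else 0) := by
    refine Fintype.sum_equiv ((Equiv.inv _).trans (Equiv.mulLeft σ)) _ _ fun τ => ?_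
    simp
  -- When lengths do not add, the height `length σ - length ρ` lies below the length of `ρ⁻¹ * σ`,
  -- so the expansion coefficient is zero; the additivity condition can therefore be dropped.
  have hterm : ∀ ρ : Perm (Fin k), ρ ≠ 1 →
      (if length ρ + length (ρ⁻¹ * σ) = length σ then
        leadingCoeff (cyclePartition (ρ⁻¹ * σ)) else 0) =
      if ρ ≠ 1 ∧ length ρ ≤ length σ then
        expansionCoeff (cyclePartition (ρ⁻¹ * σ)) (length σ - length ρ) else 0 := fun ρ hρ => by
    have h1 := length_mul_le ρ (ρ⁻¹ * σ)
    rw [mul_inv_cancel_left] at h1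
    by_cases h2 : length ρ + length (ρ⁻¹ * σ) = length σ
    · rw [if_pos h2, if_pos ⟨hρ, by omega⟩, leadingCoeff]
      congr 1
      change length (ρ⁻¹ * σ) = _
      omega
    · rw [if_neg h2]
      split_ifs with h3
      · rw [expansionCoeff_eq_zero_of_lt (by omega)]
      · rfl
  -- Here `ρ` is the first factor; removing it lowers `i` by one and flips the sign.
  have hσ : leadingCoeff (cyclePartition σ) = (if σ = 1 then 1 else 0) -
      ∑ ρ : Perm (Fin k), if ρ ≠ 1 ∧ length ρ ≤ length σ then
        expansionCoeff (cyclePartition (ρ⁻¹ * σ)) (length σ - length ρ) else 0 := by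
    have h1 : leadingCoeff (cyclePartition σ) = expansionCoeff (cyclePartition σ) (length σ) := rfl
    rw [h1, expansionCoeff_eq_sum_range σ (Nat.le_succ _), Finset.sum_range_succ',
      nontrivialFactorizations_zero, add_comm, sub_eq_add_neg, ← Finset.sum_neg_distrib]
    congr 1
    · simp
    · simp only [nontrivialFactorizations_succ]
      push_cast
      simp only [Finset.mul_sum]
      rw [Finset.sum_comm]
      refine Finset.sum_congr rfl fun ρ _ => ?_
      split_ifs with h2
      · rw [expansionCoeff_eq_sum_range (N := length σ + 1) _ (by omega), ← Finset.sum_neg_distrib]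
        exact Finset.sum_congr rfl fun i _ => by ring
      · simp
  rw [hreindex, ← Finset.add_sum_erase _ _ (Finset.mem_univ (1 : Perm (Fin k))),
    Finset.sum_congr rfl fun ρ hρ => hterm ρ (Finset.ne_of_mem_erase hρ),
    Finset.sum_erase _ (by simp)]
  simp [hσ]

/-! ### The limit of the rescaled Weingarten function -/

/-- The matrix of the equations for the rescaled Weingarten function, as a function of `z = d⁻¹`. -/
def geodesicMatrix (k : ℕ) (z : ℝ) : Matrix (Perm (Fin k)) (Perm (Fin k)) ℝ :=
  .of fun σ τ => z ^ (length (σ * τ⁻¹) + length τ - length σ)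

theorem length_le_length_mul_inv_add {k : ℕ} (σ τ : Perm (Fin k)) :
    length σ ≤ length (σ * τ⁻¹) + length τ := by
  have h := length_mul_le (σ * τ⁻¹) τ
  rwa [inv_mul_cancel_right] at h

theorem geodesicMatrix_zero_apply {k : ℕ} (σ τ : Perm (Fin k)) :
    geodesicMatrix k 0 σ τ = if length (σ * τ⁻¹) + length τ = length σ then 1 else 0 := by
  have h := length_le_length_mul_inv_add σ τ
  rw [geodesicMatrix, Matrix.of_apply, zero_pow_eq]
  exact if_congr (by omega) rfl rfl

/-- In row `σ` the diagonal entry is one, and any other nonzero entry sits at a `τ` strictly shorter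
than `σ`; a kernel vector vanishes by induction on length. -/
theorem isUnit_geodesicMatrix_zero (k : ℕ) : IsUnit (geodesicMatrix k 0) := by
  rw [← Matrix.mulVec_injective_iff_isUnit]
  refine (injective_iff_map_eq_zero (geodesicMatrix k 0).mulVecLin).2 fun u hu => ?_
  have key : ∀ n, ∀ σ : Perm (Fin k), length σ = n → u σ = 0 := by
    intro n
    induction n using Nat.strong_induction_on with
    | _ n ih =>
      intro σ hσ
      have h := congrFun hu σ
      simp only [Matrix.mulVecLin_apply, Matrix.mulVec, dotProduct, geodesicMatrix_zero_apply,
        Pi.zero_apply] at h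
      rw [Finset.sum_eq_single σ] at h
      · simpa using h
      · intro τ _ hτ
        split_ifs with h1
        · have h2 : 0 < length (σ * τ⁻¹) := length_pos fun h3 => hτ (mul_inv_eq_one.1 h3).symm
          rw [ih (length τ) (by omega) τ rfl, mul_zero]
        · rw [zero_mul]
      · simp
  exact funext fun σ => key _ σ rfl

theorem continuous_geodesicMatrix (k : ℕ) : Continuous (geodesicMatrix k) :=
  continuous_matrix fun _ _ => continuous_pow _

theorem geodesicMatrix_mulVec_Wg {k : ℕ} {d : ℝ} (hd : (k : ℝ) < d) :
    (geodesicMatrix k d⁻¹).mulVec (fun σ => d ^ (k + length σ) * Wg d σ) = Pi.single 1 1 := by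
  have hd0 : d ≠ 0 := ((Nat.cast_nonneg k).trans_lt hd).ne'
  ext σ
  have h := congrArg (fun x => d ^ length σ * x)
    (sum_pow_numCycles_mul_Wg (by linarith : (k : ℝ) - 1 < d) σ)
  simp only [Finset.mul_sum] at h
  have hr : d ^ length σ * (if σ = 1 then 1 else 0) = (Pi.single 1 1 : Perm (Fin k) → ℝ) σ := by
    rw [Pi.single_apply]
    split_ifs with h1
    · simp [h1]
    · simp
  rw [← hr, ← h, Matrix.mulVec, dotProduct]
  refine Finset.sum_congr rfl fun τ _ => ?_
  have h1 := length_le_length_mul_inv_add σ τ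
  have h2 := numCycles_add_length (σ * τ⁻¹)
  -- The truncated subtraction is exact by `h1`; the first summand cancels the power of `d⁻¹` in the
  -- matrix.
  have h3 : k + length τ = (length (σ * τ⁻¹) + length τ - length σ) +
      (length σ + numCycles (σ * τ⁻¹)) := by omega
  rw [geodesicMatrix, Matrix.of_apply, h3, pow_add, inv_pow, ← mul_assoc, ← mul_assoc,
    inv_mul_cancel₀ (pow_ne_zero _ hd0), one_mul, pow_add, mul_assoc]

theorem tendsto_Wg {k : ℕ} (σ : Perm (Fin k)) :
    Tendsto (fun d : ℝ => d ^ (k + length σ) * Wg d σ) atTop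
      (𝓝 (leadingCoeff (cyclePartition σ) : ℝ)) := by
  have hdet0 : (geodesicMatrix k 0).det ≠ 0 :=
    ((Matrix.isUnit_iff_isUnit_det _).1 (isUnit_geodesicMatrix_zero k)).ne_zero
  have hM : Tendsto (fun d : ℝ => geodesicMatrix k d⁻¹) atTop (𝓝 (geodesicMatrix k 0)) :=
    ((continuous_geodesicMatrix k).tendsto 0).comp tendsto_inv_atTop_zero
  have hdet : Tendsto (fun d : ℝ => (geodesicMatrix k d⁻¹).det) atTop
      (𝓝 (geodesicMatrix k 0).det) := (continuous_id.matrix_det.tendsto _).comp hM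
  have hinv : Tendsto (fun d : ℝ => (geodesicMatrix k d⁻¹)⁻¹) atTop
      (𝓝 (geodesicMatrix k 0)⁻¹) := by
    simp only [Matrix.inv_def, Ring.inverse_eq_inv']
    exact (hdet.inv₀ hdet0).smul ((continuous_id.matrix_adjugate.tendsto _).comp hM)
  have hlim : (geodesicMatrix k 0)⁻¹.mulVec (Pi.single 1 1) =
      fun τ => (leadingCoeff (cyclePartition τ) : ℝ) := by
    have h0 : (geodesicMatrix k 0).mulVec (fun τ => (leadingCoeff (cyclePartition τ) : ℝ)) =
        Pi.single 1 1 := by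
      ext τ
      have h := congrArg (Int.cast : ℤ → ℝ) (sum_leadingCoeff τ)
      push_cast at h
      rw [Pi.single_apply, ← h, Matrix.mulVec, dotProduct]
      exact Finset.sum_congr rfl fun ρ _ => by rw [geodesicMatrix_zero_apply, ite_mul]; simp
    rw [← h0, Matrix.mulVec_mulVec, Matrix.nonsing_inv_mul _ hdet0.isUnit, Matrix.one_mulVec]
  have hvec : Tendsto (fun d : ℝ => (geodesicMatrix k d⁻¹)⁻¹.mulVec (Pi.single 1 1) σ) atTop
      (𝓝 (leadingCoeff (cyclePartition σ) : ℝ)) := by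
    rw [← congrFun hlim σ]
    have hc : Continuous fun A : Matrix (Perm (Fin k)) (Perm (Fin k)) ℝ =>
        A.mulVec (Pi.single 1 1) σ :=
      (continuous_apply σ).comp (continuous_id.matrix_mulVec continuous_const)
    exact (hc.tendsto _).comp hinv
  refine hvec.congr' ?_
  filter_upwards [eventually_gt_atTop (k : ℝ), hdet.eventually_ne hdet0] with d hd hd'
  rw [← geodesicMatrix_mulVec_Wg hd, Matrix.mulVec_mulVec, Matrix.nonsing_inv_mul _ hd'.isUnit,
    Matrix.one_mulVec]

/-! ### The recursion for `C` and its closed form -/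

theorem leadingCoeff_congr {k : ℕ} {σ τ : Perm (Fin k)} (h : σ.cycleType = τ.cycleType) :
    leadingCoeff (cyclePartition σ) = leadingCoeff (cyclePartition τ) := by
  rw [cyclePartition_eq_iff.2 h]

theorem cycleType_mul_swap {α : Type*} [DecidableEq α] [Fintype α] (σ : Perm α) (x y : α) :
    (σ * swap x y).cycleType = (swap x y * σ).cycleType := by
  rw [← Perm.cycleType_conj (σ := σ * swap x y) (τ := swap x y)]
  congr 1
  simp [mul_assoc]

-- Scale `Wg_swap_recursion` by `d ^ (k + length σ)` and let `d → ∞`. A transposition inside the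
-- cycle of `0` lowers the length by one, exactly the scale of `tendsto_Wg` in `S_{k+1}`; any other
-- raises it by one, leaving a factor `d⁻²` that kills the term.
open Classical in
theorem leadingCoeff_swap_recursion {k : ℕ} {σ : Perm (Fin (k + 1))} (hσ : σ 0 ≠ 0) :
    leadingCoeff (cyclePartition σ) + ∑ p : Fin k, (if σ.SameCycle 0 p.succ then
      leadingCoeff (cyclePartition (swap 0 p.succ * σ)) else 0) = 0 := by
  have hterm : ∀ p : Fin k, Tendsto
      (fun d : ℝ => d ^ (k + length σ) * Wg d (σ * swap 0 p.succ)) atTop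
      (𝓝 ((if σ.SameCycle 0 p.succ then
        leadingCoeff (cyclePartition (swap 0 p.succ * σ)) else 0 : ℤ) : ℝ)) := by
    intro p
    have hl : length (σ * swap 0 p.succ) = length (swap 0 p.succ * σ) :=
      length_congr (cycleType_mul_swap _ _ _)
    have ht := tendsto_Wg (σ * swap 0 p.succ)
    rw [hl, leadingCoeff_congr (cycleType_mul_swap _ _ _)] at ht
    split_ifs with h
    · have h1 := length_swap_mul_of_sameCycle (Fin.succ_ne_zero p).symm h
      have h2 : k + length σ = k + 1 + length (swap 0 p.succ * σ) := by omega
      rwa [h2]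
    · have h1 := length_swap_mul_of_not_sameCycle h
      have h2 := (tendsto_inv_atTop_zero (𝕜 := ℝ)).pow 2 |>.mul ht
      rw [zero_pow two_ne_zero, zero_mul] at h2
      rw [Int.cast_zero]
      refine h2.congr' ?_
      filter_upwards [eventually_gt_atTop (0 : ℝ)] with d hd
      have h3 : k + 1 + length (swap 0 p.succ * σ) = 2 + (k + length σ) := by omega
      rw [h3, pow_add, inv_pow, ← mul_assoc, ← mul_assoc, inv_mul_cancel₀ (by positivity), one_mul]
  have hsum := (tendsto_Wg σ).add (tendsto_finsetSum Finset.univ fun p _ => hterm p)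
  have hzero : (fun d : ℝ => d ^ (k + 1 + length σ) * Wg d σ +
      ∑ p : Fin k, d ^ (k + length σ) * Wg d (σ * swap 0 p.succ)) =ᶠ[atTop] fun _ => 0 := by
    filter_upwards [eventually_gt_atTop (k : ℝ)] with d hd
    have h := congrArg (fun x => d ^ (k + length σ) * x) (Wg_swap_recursion hd hσ)
    simp only [mul_add, mul_zero, Finset.mul_sum] at h
    rw [← h, show k + 1 + length σ = k + length σ + 1 by omega, pow_succ, mul_assoc]
  have h := tendsto_nhds_unique (hsum.congr' hzero) tendsto_const_nhds
  exact_mod_cast h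

theorem leadingCoeff_one (k : ℕ) : leadingCoeff (cyclePartition (1 : Perm (Fin k))) = 1 := by
  have h := sum_leadingCoeff (1 : Perm (Fin k))
  rw [Finset.sum_eq_single 1] at h
  · simpa using h
  · intro τ _ hτ
    have := length_pos hτ
    rw [length_one, if_neg (by omega)]
  · simp

theorem leadingCoeff_cyclePartition {k : ℕ} (σ : Perm (Fin k)) :
    leadingCoeff (cyclePartition σ) = catalanValue σ := by
  classical
  generalize hn : length σ = n
  induction n using Nat.strong_induction_on generalizing σ with
  | _ n ih =>
    by_cases h1 : σ = 1
    · simp [h1, leadingCoeff_one, catalanValue]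
    · obtain ⟨x, hx⟩ : ∃ x, σ x ≠ x := by
        by_contra! h
        exact h1 (Equiv.ext h)
      rcases k with _ | k
      · exact x.elim0
      -- The recursion is based at `0`, so conjugation moves the nonfixed point `x` there; both
      -- sides depend only on the cycle type.
      have hc : (swap 0 x * σ * (swap 0 x)⁻¹).cycleType = σ.cycleType := Perm.cycleType_conj
      have hσ0 : (swap 0 x * σ * (swap 0 x)⁻¹) 0 ≠ 0 := by
        simpa [swap_inv, swap_apply_eq_iff] using hx
      rw [← leadingCoeff_congr hc, catalanValue, ← hc, ← catalanValue]
      rw [← length_congr hc] at hn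
      generalize swap 0 x * σ * (swap 0 x)⁻¹ = σ' at hn hσ0
      have h2 := leadingCoeff_swap_recursion hσ0
      have h3 := sum_catalanValue_swap_mul hσ0
      rw [Finset.sum_filter, Fin.sum_univ_succ] at h3
      simp only [ne_eq, not_true_eq_false, false_and, if_false, zero_add, Fin.succ_ne_zero,
        not_false_eq_true, true_and] at h3
      have h4 : ∀ p : Fin k, (if σ'.SameCycle 0 p.succ then
          leadingCoeff (cyclePartition (swap 0 p.succ * σ')) else 0) =
          if σ'.SameCycle 0 p.succ then catalanValue (swap 0 p.succ * σ') else 0 := fun p => by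
        split_ifs with h5
        · have h6 := length_swap_mul_of_sameCycle (Fin.succ_ne_zero p).symm h5
          exact ih _ (by omega) _ rfl
        · rfl
      rw [Finset.sum_congr rfl fun p _ => h4 p, h3] at h2
      linarith

theorem leadingCoeff_eq_prod_signedCatalan {k : ℕ} (μ : k.Partition) :
    leadingCoeff μ = (μ.parts.map signedCatalan).prod := by
  obtain ⟨σ, rfl⟩ := exists_cyclePartition_eq μ
  have h : (cyclePartition σ).parts =
      σ.cycleType + Multiset.replicate (Fintype.card (Fin k) - σ.support.card) 1 := rfl
  rw [leadingCoeff_cyclePartition, h, catalanValue]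
  simp

theorem leadingCoeff_indiscrete {k : ℕ} (hk : 1 ≤ k) :
    leadingCoeff (Nat.Partition.indiscrete k) = signedCatalan k := by
  rw [leadingCoeff_eq_prod_signedCatalan, Nat.Partition.indiscrete_parts (by omega)]
  simp

end Weingarten

end

theorem mainTheorem2 :
    -- the Weingarten function is defined by a genuine inverse, and `C[μ]` is its leading coefficient
    (∀ (k : ℕ) (d : ℝ), (k : ℝ) - 1 < d → IsUnit (Weingarten.cycleElement k d)) ∧
    (∀ (k : ℕ) (σ : Equiv.Perm (Fin k)),
      Tendsto (fun d : ℝ => d ^ (k + Weingarten.length σ) * Weingarten.Wg d σ) atTop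
        (𝓝 (Weingarten.leadingCoeff (Weingarten.cyclePartition σ) : ℝ))) ∧
    -- its value on a full cycle
    (∀ k : ℕ, 1 ≤ k →
      Weingarten.leadingCoeff (Nat.Partition.indiscrete k) = (-1) ^ (k - 1) * (catalan (k - 1) : ℤ)) ∧
    -- multiplicativity over the cycles
    (∀ (k : ℕ) (μ : Nat.Partition k),
      Weingarten.leadingCoeff μ =
        (μ.parts.map fun a => Weingarten.leadingCoeff (Nat.Partition.indiscrete a)).prod) ∧
    -- length-additive factorizations stay in the Young subgroup of the cycles
    (∀ (k : ℕ) (σ : Equiv.Perm (Fin k)) (l : List (Equiv.Perm (Fin k))),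
      (∀ τ ∈ l, τ ≠ 1) → l.prod = σ → (l.map Weingarten.length).sum = Weingarten.length σ →
        ∀ τ ∈ l, τ ∈ Weingarten.youngSubgroup (Equiv.Perm.SameCycle.setoid σ)) := by
  refine ⟨Weingarten.isUnit_cycleElement, fun k σ => Weingarten.tendsto_Wg σ,
    fun k hk => Weingarten.leadingCoeff_indiscrete hk, fun k μ => ?_, ?_⟩
  · rw [Weingarten.leadingCoeff_eq_prod_signedCatalan]
    congr 1
    exact Multiset.map_congr rfl fun a ha =>
      (Weingarten.leadingCoeff_indiscrete (μ.parts_pos ha)).symm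
  · rintro k σ l - rfl h τ hτ
    exact Weingarten.mem_youngSubgroup_of_length_prod h τ hτ
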